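/- Let $d\ge 2$ and $0<a<b$. Let $(t_e)$ be independent random variables indexed by the nearest-neighbour edges $e$ of $\mathbb{Z}^d$ (edges between points at $\ell^1$-distance $1$), all with distribution $\mu=\frac12\delta_a+\frac12\delta_b$. For $n\ge 1$ let $$T_n=\inf_{\gamma}\sum_{e\in\gamma}t_e$$ be the first-passage time from $0$ to $n\mathbf{e}_1=(n,0,\dots,0)$, where the infimum is over all finite nearest-neighbour lattice paths $\gamma$ from $0$ to $n\mathbf{e}_1$. Then there is a constant $C>0$, depending only on $d$, $a$ and $b$, such that for every integer $n\ge 2$ the variable $T_n$ is square-integrable and $$\mathbf{Var}(T_n)\le C\,\frac{n}{\log n}.$$ -/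

import Mathlib

open MeasureTheory ProbabilityTheory
open scoped ENNReal

namespace FPP

/-- The nearest-neighbour graph on `ℤ^d`: two points are adjacent when their `ℓ¹`-distance is `1`. -/
def lattice (d : ℕ) : SimpleGraph (Fin d → ℤ) where
  Adj x y := ∑ i, |x i - y i| = 1
  symm := ⟨fun x y h => by simpa only [abs_sub_comm] using h⟩
  loopless := ⟨fun x h => by simp at h⟩

/-- The set of (undirected) nearest-neighbour edges of `ℤ^d`, as a type. -/
abbrev Edge (d : ℕ) : Type := (lattice d).edgeSet

/-- The total weight of a lattice path `γ`, each traversed edge being counted with multiplicity. -/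
def pathWeight {d : ℕ} (w : Edge d → ℝ) {x y : Fin d → ℤ} (γ : (lattice d).Walk x y) : ℝ :=
  (γ.darts.map fun s => w ⟨s.edge, s.edge_mem⟩).sum

/-- The passage time `T(x, y)`: the infimum of the weights of the finite lattice paths
from `x` to `y`. -/
noncomputable def passageTime {d : ℕ} (w : Edge d → ℝ) (x y : Fin d → ℤ) : ℝ :=
  ⨅ γ : (lattice d).Walk x y, pathWeight w γ

/-- The point `n e₁ = (n, 0, …, 0)` of `ℤ^d`. -/
def axisPoint (d n : ℕ) : Fin d → ℤ := fun i => if i.val = 0 then (n : ℤ) else 0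

/-- The probability measure `½ δ_a + ½ δ_b` on `ℝ`. -/
noncomputable def bernoulliLaw (a b : ℝ) : Measure ℝ :=
  (2⁻¹ : ℝ≥0∞) • Measure.dirac a + (2⁻¹ : ℝ≥0∞) • Measure.dirac b

end FPP

/-!
The variance of a first-passage time is sublinear because the uniform measure on the cube of edge
configurations is hypercontractive, while every single edge has little influence on a suitably
averaged passage time.

*The cube.* For a function `f` of finitely many fair bits, let `influence i f` be half the
difference of `f` across the bit `i`. Its Walsh coefficients are those of `f` at the sets
containing `i`. In `avg_sq_sub_sq_avg_le` the variance, which is the sum of the squared Walsh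
coefficients at nonempty sets, is split at a level `K`. The part above `K` gains a factor `1 / K`
over the Efron–Stein bound. The part below `K` is controlled through `bonami` by
`3 ^ K * ‖g‖₁ * ‖g‖₂` with `g = influence i f`, which for a bounded `g` is at most of
order `3 ^ K * ‖g‖₁ ^ (3/2)`, hence negligible against `‖g‖₁` when `‖g‖₁` is small.

*Influences and geodesics.* Weights with values in `{a, b}` have geodesics, and changing the weight
of an edge `e` alters the passage time by at most `b - a`, and only if `e` is essential, that is,
lies on every geodesic, in one of the two configurations (`abs_passageTime_sub_flip_le`). There are
at most `b n / a` essential edges, so the influences have a sum of order `n`. Moreover a geodesic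
has at most `O(R)` edges in a set of diameter `R` (`IsGeodesic.card_le`), since between two of its
points it is at most as heavy as a shortest lattice path.

*Averaging.* The passage time from `x` to `y` is replaced by `averagedTime`, the mean over `z` in a
box of side `m` of the passage times from `x + z` to `y + z`; this costs `O(m)`. By translation
invariance, the mean influence of an edge on the averaged time is at most a multiple of the
proportion of the translates of the edge by the box which are essential from `x` to `y`, hence
`O(m ^ (1 - d))`. The choice `m ≈ n ^ (1/4)`, `K ≈ log n / 32` gives the bound.
-/

namespace FPP

/-! ### Fourier analysis on the discrete cube -/

section Cube

variable {ι : Type*} [DecidableEq ι]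

/-- The configuration obtained from `x` by changing its value at the coordinate `i`. -/
def flip (i : ι) (x : ι → Bool) : ι → Bool := Function.update x i (!x i)

@[simp] lemma flip_self (i : ι) (x : ι → Bool) : flip i x i = !x i := by simp [flip]

lemma flip_of_ne {i j : ι} (h : j ≠ i) (x : ι → Bool) : flip i x j = x j := by simp [flip, h]

@[simp] lemma flip_flip (i : ι) (x : ι → Bool) : flip i (flip i x) = x := by
  ext j
  by_cases h : j = i
  · subst h; simp
  · simp [flip_of_ne h]

/-- The sign `±1` attached to a bit. -/
def sign (c : Bool) : ℝ := if c then 1 else -1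

lemma sign_not (c : Bool) : sign (!c) = -sign c := by cases c <;> simp [sign]

lemma sign_mul_self (c : Bool) : sign c * sign c = 1 := by cases c <;> simp [sign]

lemma sign_mul_of_ne {c c' : Bool} (h : c ≠ c') : sign c * sign c' = -1 := by
  cases c <;> cases c' <;> simp [sign] at *

/-- The Walsh character `χ_S`. -/
def walsh (S : Finset ι) (x : ι → Bool) : ℝ := ∏ i ∈ S, sign (x i)

lemma walsh_flip_of_notMem {S : Finset ι} {i : ι} (h : i ∉ S) (x : ι → Bool) :
    walsh S (flip i x) = walsh S x :=
  Finset.prod_congr rfl fun j hj => by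
    rw [flip_of_ne (by rintro rfl; exact h hj)]

lemma walsh_insert {S : Finset ι} {i : ι} (h : i ∉ S) (x : ι → Bool) :
    walsh (insert i S) x = sign (x i) * walsh S x := Finset.prod_insert h

lemma walsh_flip_of_mem {S : Finset ι} {i : ι} (h : i ∈ S) (x : ι → Bool) :
    walsh S (flip i x) = -walsh S x := by
  rw [← Finset.insert_erase h, walsh_insert (Finset.notMem_erase i S),
    walsh_insert (Finset.notMem_erase i S), walsh_flip_of_notMem (Finset.notMem_erase i S),
    flip_self, sign_not, neg_mul]

variable [Fintype ι]

/-- The mean of `f` under the uniform measure on the cube. -/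
noncomputable def avg (f : (ι → Bool) → ℝ) : ℝ := (∑ x, f x) / 2 ^ Fintype.card ι

lemma avg_add (f g : (ι → Bool) → ℝ) : avg (fun x => f x + g x) = avg f + avg g := by
  simp [avg, Finset.sum_add_distrib, add_div]

lemma avg_sub (f g : (ι → Bool) → ℝ) : avg (fun x => f x - g x) = avg f - avg g := by
  simp [avg, Finset.sum_sub_distrib, sub_div]

lemma avg_const_mul (c : ℝ) (f : (ι → Bool) → ℝ) : avg (fun x => c * f x) = c * avg f := by
  simp [avg, ← Finset.mul_sum, mul_div_assoc]

lemma avg_const (c : ℝ) : avg (fun _ : ι → Bool => c) = c := by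
  simp [avg]

lemma avg_sum {α : Type*} (s : Finset α) (f : α → (ι → Bool) → ℝ) :
    avg (fun x => ∑ k ∈ s, f k x) = ∑ k ∈ s, avg (f k) := by
  simp only [avg]
  rw [Finset.sum_comm, Finset.sum_div]

lemma avg_mono {f g : (ι → Bool) → ℝ} (h : ∀ x, f x ≤ g x) : avg f ≤ avg g := by
  unfold avg
  gcongr
  exact h _

lemma avg_nonneg {f : (ι → Bool) → ℝ} (h : ∀ x, 0 ≤ f x) : 0 ≤ avg f :=
  div_nonneg (Finset.sum_nonneg fun x _ => h x) (by positivity)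

lemma avg_flip (i : ι) (f : (ι → Bool) → ℝ) : avg (fun x => f (flip i x)) = avg f := by
  unfold avg
  congr 1
  exact Finset.sum_nbij' (flip i) (flip i) (by simp) (by simp) (by simp) (by simp) (by simp)

/-- The Cauchy–Schwarz inequality on the cube. -/
lemma sq_avg_mul_le (f g : (ι → Bool) → ℝ) :
    avg (fun x => f x * g x) ^ 2 ≤ avg (fun x => f x ^ 2) * avg (fun x => g x ^ 2) := by
  unfold avg
  rw [div_pow, div_mul_div_comm, ← sq]
  gcongr
  exact Finset.sum_mul_sq_le_sq_mul_sq _ _ _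

lemma avg_mul_sign (i : ι) {f : (ι → Bool) → ℝ} (hf : ∀ x, f (flip i x) = f x) :
    avg (fun x => f x * sign (x i)) = 0 := by
  have h := avg_flip i (fun x => f x * sign (x i))
  simp only [hf, flip_self, sign_not] at h
  have h2 := avg_const_mul (-1) (fun x => f x * sign (x i))
  simp only [neg_mul, one_mul, mul_neg] at h h2
  linarith

/-- The Walsh–Fourier coefficient `f̂(S)`. -/
noncomputable def coeff (f : (ι → Bool) → ℝ) (S : Finset ι) : ℝ := avg (fun x => f x * walsh S x)

lemma coeff_empty (f : (ι → Bool) → ℝ) : coeff f ∅ = avg f := by simp [coeff, walsh]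

omit [DecidableEq ι] in
/-- Orthogonality of the Walsh characters, summed over all characters. -/
lemma sum_walsh_mul_walsh (x y : ι → Bool) :
    ∑ S : Finset ι, walsh S x * walsh S y = if x = y then 2 ^ Fintype.card ι else 0 := by
  have h : ∑ S : Finset ι, walsh S x * walsh S y = ∏ i, (1 + sign (x i) * sign (y i)) := by
    rw [Finset.prod_one_add, Finset.powerset_univ]
    exact Finset.sum_congr rfl fun S _ => Finset.prod_mul_distrib.symm
  rw [h]
  split_ifs with hxy
  · subst hxy
    simp only [sign_mul_self]
    norm_num
  · obtain ⟨i, hi⟩ := Function.ne_iff.1 hxy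
    exact Finset.prod_eq_zero (Finset.mem_univ i) (by rw [sign_mul_of_ne hi]; ring)

lemma sum_coeff_mul_walsh (f : (ι → Bool) → ℝ) (y : ι → Bool) :
    ∑ S, coeff f S * walsh S y = f y := by
  simp only [coeff, avg, div_mul_eq_mul_div, Finset.sum_mul]
  rw [← Finset.sum_div, Finset.sum_comm]
  simp only [mul_assoc, ← Finset.mul_sum, sum_walsh_mul_walsh]
  simp

lemma parseval (f : (ι → Bool) → ℝ) : ∑ S, coeff f S ^ 2 = avg (fun x => f x ^ 2) := by
  have h : ∀ x, f x ^ 2 = ∑ S, coeff f S * (f x * walsh S x) := fun x => by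
    conv_lhs => rw [sq]; arg 2; rw [← sum_coeff_mul_walsh f x]
    rw [Finset.mul_sum]
    exact Finset.sum_congr rfl fun S _ => by ring
  simp only [h, avg_sum, avg_const_mul]
  exact Finset.sum_congr rfl fun S _ => by rw [sq]; rfl

/-- **Bonami's inequality**: damping the Walsh coefficients at level `k` by `r ^ k` with
`3 r² = 1` maps `L²` contractively to `L⁴`. The induction splits off one coordinate at a time. -/
lemma bonami {r : ℝ} (hr : r ^ 2 = 1 / 3) (U : Finset ι) (c : Finset ι → ℝ) :
    avg (fun x => (∑ S ∈ U.powerset, r ^ S.card * c S * walsh S x) ^ 4)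
      ≤ (∑ S ∈ U.powerset, c S ^ 2) ^ 2 := by
  induction U using Finset.induction_on generalizing c with
  | empty => simpa [walsh, avg_const] using le_of_eq (by ring)
  | insert i U hi ih =>
    have hmem : ∀ S ∈ U.powerset, i ∉ S := fun S hS h => hi (Finset.mem_powerset.1 hS h)
    set g : (ι → Bool) → ℝ := fun x => ∑ S ∈ U.powerset, r ^ S.card * c S * walsh S x with hg
    set h : (ι → Bool) → ℝ :=
      fun x => ∑ S ∈ U.powerset, r ^ S.card * c (insert i S) * walsh S x with hh
    have hgi : ∀ x, g (flip i x) = g x := fun x =>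
      Finset.sum_congr rfl fun S hS => by rw [walsh_flip_of_notMem (hmem S hS)]
    have hhi : ∀ x, h (flip i x) = h x := fun x =>
      Finset.sum_congr rfl fun S hS => by rw [walsh_flip_of_notMem (hmem S hS)]
    have hsplit : ∀ x, ∑ S ∈ (insert i U).powerset, r ^ S.card * c S * walsh S x
        = g x + r * sign (x i) * h x := fun x => by
      rw [Finset.sum_powerset_insert hi, hg, hh, Finset.mul_sum]
      congr 1
      refine Finset.sum_congr rfl fun S hS => ?_
      rw [Finset.card_insert_of_notMem (hmem S hS), walsh_insert (hmem S hS)]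
      ring
    have hexp : ∀ x, (g x + r * sign (x i) * h x) ^ 4
        = (g x ^ 4 + 2 * (g x ^ 2 * h x ^ 2) + 1 / 9 * h x ^ 4)
          + (4 * r * g x ^ 3 * h x + 4 / 3 * r * g x * h x ^ 3) * sign (x i) := fun x => by
      have hs : sign (x i) ^ 2 = 1 := by rw [sq, sign_mul_self]
      have hs3 : sign (x i) ^ 3 = sign (x i) := by rw [pow_succ, hs, one_mul]
      have hs4 : sign (x i) ^ 4 = 1 := by
        rw [show sign (x i) ^ 4 = (sign (x i) ^ 2) ^ 2 by ring, hs, one_pow]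
      have hr3 : r ^ 3 = r / 3 := by rw [pow_succ, hr]; ring
      have hr4 : r ^ 4 = 1 / 9 := by rw [show r ^ 4 = (r ^ 2) ^ 2 by ring, hr]; norm_num
      calc (g x + r * sign (x i) * h x) ^ 4
          = g x ^ 4 + 4 * r * g x ^ 3 * h x * sign (x i)
            + 6 * r ^ 2 * sign (x i) ^ 2 * (g x ^ 2 * h x ^ 2)
            + 4 * r ^ 3 * sign (x i) ^ 3 * g x * h x ^ 3
            + r ^ 4 * sign (x i) ^ 4 * h x ^ 4 := by ring
        _ = _ := by rw [hr, hs, hr3, hs3, hr4, hs4]; ring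
    simp only [hsplit, hexp]
    rw [avg_add, avg_mul_sign i (fun x => by rw [hgi, hhi]), add_zero, avg_add, avg_add,
      avg_const_mul, avg_const_mul, Finset.sum_powerset_insert hi]
    have h1 := ih c
    have h2 := ih (fun S => c (insert i S))
    set A := ∑ S ∈ U.powerset, c S ^ 2
    set B := ∑ S ∈ U.powerset, c (insert i S) ^ 2
    have hA : 0 ≤ A := Finset.sum_nonneg fun _ _ => sq_nonneg _
    have hB : 0 ≤ B := Finset.sum_nonneg fun _ _ => sq_nonneg _
    have h3 : avg (fun x => g x ^ 2 * h x ^ 2) ≤ A * B := by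
      refine le_of_sq_le_sq ?_ (mul_nonneg hA hB)
      refine (sq_avg_mul_le _ _).trans ?_
      rw [mul_pow]
      simp only [← pow_mul, Nat.reduceMul]
      exact mul_le_mul h1 h2 (avg_nonneg fun x => by positivity) (sq_nonneg _)
    nlinarith [sq_nonneg B]

/-- The dual form of Bonami's inequality: the damped energy of `f` is small when `f` is small
in `L¹`. -/
lemma sum_damped_coeff_sq_le (f : (ι → Bool) → ℝ) :
    ∑ S, (1 / 3 : ℝ) ^ S.card * coeff f S ^ 2
      ≤ avg (fun x => |f x|) * √(avg (fun x => f x ^ 2)) := by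
  obtain ⟨r, hr⟩ : ∃ r : ℝ, r ^ 2 = 1 / 3 := ⟨√(1 / 3), Real.sq_sqrt (by norm_num)⟩
  set Q := ∑ S, (1 / 3 : ℝ) ^ S.card * coeff f S ^ 2 with hQ
  have hQ0 : 0 ≤ Q := Finset.sum_nonneg fun S _ => by positivity
  set h : (ι → Bool) → ℝ := fun x => ∑ S, (1 / 3 : ℝ) ^ S.card * coeff f S * walsh S x with hh
  have h4 : avg (fun x => h x ^ 4) ≤ Q ^ 2 := by
    have := bonami hr Finset.univ (fun S => r ^ S.card * coeff f S)
    have e1 : ∀ x, ∑ S ∈ (Finset.univ : Finset ι).powerset,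
        r ^ S.card * (r ^ S.card * coeff f S) * walsh S x = h x := fun x => by
      rw [Finset.powerset_univ]
      refine Finset.sum_congr rfl fun S _ => ?_
      rw [← hr, ← pow_mul, mul_comm 2, pow_mul]; ring
    have e2 : ∑ S ∈ (Finset.univ : Finset ι).powerset, (r ^ S.card * coeff f S) ^ 2 = Q := by
      rw [Finset.powerset_univ]
      refine Finset.sum_congr rfl fun S _ => ?_
      rw [← hr, ← pow_mul, mul_comm 2, pow_mul]; ring
    simpa only [e1, e2] using this
  have hQe : Q = avg (fun x => f x * h x) := by
    simp only [hh, Finset.mul_sum]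
    rw [avg_sum]
    refine Finset.sum_congr rfl fun S _ => ?_
    rw [sq, ← mul_assoc]
    conv_lhs => arg 2; rw [coeff]
    rw [← avg_const_mul]
    congr 1; ext x; ring
  set E1 := avg (fun x => |f x|)
  set E2 := avg (fun x => f x ^ 2)
  have hE1 : 0 ≤ E1 := avg_nonneg fun x => abs_nonneg _
  have hE2 : 0 ≤ E2 := avg_nonneg fun x => sq_nonneg _
  -- Cauchy–Schwarz twice: first split off `|f| ^ (1/2)`, then separate `|f|` from `h ^ 2`.
  have hcs : avg (fun x => |f x| * h x ^ 2) ≤ √E2 * Q := by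
    refine le_of_sq_le_sq ?_ (by positivity)
    refine (sq_avg_mul_le _ _).trans ?_
    rw [mul_pow, Real.sq_sqrt hE2]
    simp only [sq_abs, ← pow_mul, Nat.reduceMul]
    exact mul_le_mul_of_nonneg_left h4 hE2
  have hQ2 : Q ^ 2 ≤ E1 * (√E2 * Q) := by
    calc Q ^ 2 ≤ (avg (fun x => √|f x| * (√|f x| * |h x|))) ^ 2 := by
          gcongr
          rw [hQe]
          refine avg_mono fun x => ?_
          rw [← mul_assoc, Real.mul_self_sqrt (abs_nonneg _), ← abs_mul]
          exact le_abs_self _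
      _ ≤ _ := sq_avg_mul_le _ _
      _ = E1 * avg (fun x => |f x| * h x ^ 2) := by
          congr 1
          · congr 1; ext x; rw [Real.sq_sqrt (abs_nonneg _)]
          · congr 1; ext x; rw [mul_pow, Real.sq_sqrt (abs_nonneg _), sq_abs]
      _ ≤ _ := mul_le_mul_of_nonneg_left hcs hE1
  rcases hQ0.eq_or_lt with h0 | h0
  · rw [← h0]; positivity
  · nlinarith

/-- Half the difference of `f` across the coordinate `i`. -/
noncomputable def influence (i : ι) (f : (ι → Bool) → ℝ) (x : ι → Bool) : ℝ :=
  (f x - f (flip i x)) / 2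

lemma coeff_influence_of_mem (f : (ι → Bool) → ℝ) {S : Finset ι} {i : ι} (h : i ∈ S) :
    coeff (influence i f) S = coeff f S := by
  have h1 := avg_flip i (fun x => f x * walsh S x)
  simp only [walsh_flip_of_mem h] at h1
  have h2 : coeff (influence i f) S
      = avg (fun x => 1 / 2 * (f x * walsh S x) + 1 / 2 * (f (flip i x) * -walsh S x)) := by
    unfold coeff influence
    congr 1; ext x; ring
  rw [h2, avg_add, avg_const_mul, avg_const_mul, h1, coeff]
  ring

/-- A Talagrand-type variance inequality. Frequencies of size at most `K` are controlled by
hypercontractivity, the others by the factor `1 / K`. -/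
theorem avg_sq_sub_sq_avg_le (f : (ι → Bool) → ℝ) {K : ℕ} (hK : 0 < K) :
    avg (fun x => f x ^ 2) - avg f ^ 2
      ≤ ∑ i, (3 ^ K * (avg (fun x => |influence i f x|) * √(avg (fun x => influence i f x ^ 2)))
          + avg (fun x => influence i f x ^ 2) / K) := by
  have hKr : (0 : ℝ) < K := by exact_mod_cast hK
  rw [← parseval, ← coeff_empty, ← Finset.sum_erase_eq_sub (Finset.mem_univ ∅)]
  have hterm : ∀ S ∈ Finset.univ.erase (∅ : Finset ι), coeff f S ^ 2
      ≤ ∑ i, (3 ^ K * ((1 / 3) ^ S.card * coeff (influence i f) S ^ 2)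
          + coeff (influence i f) S ^ 2 / K) := by
    intro S hS
    have hne : S.Nonempty := Finset.nonempty_iff_ne_empty.2 (Finset.ne_of_mem_erase hS)
    have hsub : ∑ i ∈ S, (3 ^ K * ((1 / 3) ^ S.card * coeff f S ^ 2) + coeff f S ^ 2 / K)
        ≤ ∑ i, (3 ^ K * ((1 / 3) ^ S.card * coeff (influence i f) S ^ 2)
          + coeff (influence i f) S ^ 2 / K) := by
      rw [Finset.sum_congr rfl fun i hi => by rw [← coeff_influence_of_mem f hi]]
      exact Finset.sum_le_sum_of_subset_of_nonneg (Finset.subset_univ _)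
        fun i _ _ => by positivity
    refine le_trans ?_ hsub
    rw [Finset.sum_const, nsmul_eq_mul]
    have hc : (1 : ℝ) ≤ S.card := by exact_mod_cast hne.card_pos
    have hf := sq_nonneg (coeff f S)
    rcases le_total S.card K with h | h
    · have h3 : (1 : ℝ) ≤ 3 ^ K * (1 / 3) ^ S.card := by
        rw [one_div, inv_pow, ← div_eq_mul_inv, one_le_div (by positivity)]
        exact pow_le_pow_right₀ (by norm_num) h
      have h4 : coeff f S ^ 2 ≤ 3 ^ K * ((1 / 3) ^ S.card * coeff f S ^ 2) := by
        rw [← mul_assoc]; exact le_mul_of_one_le_left hf h3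
      have h5 : 0 ≤ coeff f S ^ 2 / K := by positivity
      nlinarith
    · have h3 : (K : ℝ) ≤ S.card := by exact_mod_cast h
      have h4 : coeff f S ^ 2 ≤ S.card * (coeff f S ^ 2 / K) := by
        rw [← mul_div_assoc, le_div_iff₀ hKr, mul_comm]
        gcongr
      have h5 : 0 ≤ 3 ^ K * ((1 / 3 : ℝ) ^ S.card * coeff f S ^ 2) := by positivity
      nlinarith
  calc ∑ S ∈ Finset.univ.erase (∅ : Finset ι), coeff f S ^ 2
      ≤ ∑ S ∈ Finset.univ.erase (∅ : Finset ι),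
          ∑ i, (3 ^ K * ((1 / 3) ^ S.card * coeff (influence i f) S ^ 2)
          + coeff (influence i f) S ^ 2 / K) := Finset.sum_le_sum hterm
    _ ≤ ∑ S, ∑ i, (3 ^ K * ((1 / 3) ^ S.card * coeff (influence i f) S ^ 2)
          + coeff (influence i f) S ^ 2 / K) :=
        Finset.sum_le_sum_of_subset_of_nonneg (Finset.subset_univ _)
          fun S _ _ => Finset.sum_nonneg fun i _ => by positivity
    _ = ∑ i, (3 ^ K * ∑ S, (1 / 3) ^ S.card * coeff (influence i f) S ^ 2
          + (∑ S, coeff (influence i f) S ^ 2) / K) := by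
        rw [Finset.sum_comm]
        refine Finset.sum_congr rfl fun i _ => ?_
        rw [Finset.sum_add_distrib, Finset.mul_sum, Finset.sum_div]
    _ ≤ _ := by
        gcongr with i
        · exact sum_damped_coeff_sq_le _
        · exact (parseval _).le

end Cube

/-! ### Paths and geodesics in the lattice -/

section Lattice

variable {d : ℕ}

/-- The `ℓ¹`-distance on `ℤ^d`, as a natural number. -/
def dist1 (x y : Fin d → ℤ) : ℕ := ∑ i, (x i - y i).natAbs

lemma dist1_self (x : Fin d → ℤ) : dist1 x x = 0 := by simp [dist1]

lemma dist1_comm (x y : Fin d → ℤ) : dist1 x y = dist1 y x :=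
  Finset.sum_congr rfl fun i _ => by omega

lemma dist1_triangle (x y z : Fin d → ℤ) : dist1 x z ≤ dist1 x y + dist1 y z := by
  unfold dist1
  rw [← Finset.sum_add_distrib]
  exact Finset.sum_le_sum fun i _ => by omega

lemma adj_iff_dist1 {x y : Fin d → ℤ} : (lattice d).Adj x y ↔ dist1 x y = 1 := by
  have h : ∑ i, |x i - y i| = (dist1 x y : ℤ) := by
    simp [dist1]
  change ∑ i, |x i - y i| = 1 ↔ _
  rw [h]
  norm_cast

lemma dist1_add_right (x y z : Fin d → ℤ) : dist1 (x + z) (y + z) = dist1 x y := by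
  simp [dist1]

/-- Any two points are joined by a path as long as their `ℓ¹`-distance. -/
lemma exists_walk_length_eq_dist1 (x y : Fin d → ℤ) :
    ∃ γ : (lattice d).Walk x y, γ.length = dist1 x y := by
  induction hk : dist1 x y generalizing x with
  | zero =>
    have hxy : x = y := by
      ext i
      have := (Finset.sum_eq_zero_iff.1 hk) i (Finset.mem_univ i)
      omega
    subst hxy
    exact ⟨.nil, rfl⟩
  | succ k ih =>
    obtain ⟨i, hi⟩ : ∃ i, x i ≠ y i := by
      by_contra! h
      rw [funext h, dist1_self] at hk
      omega
    -- move one unit towards `y` along a coordinate in which `x` and `y` differ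
    obtain ⟨c, hc1, hc2⟩ : ∃ c : ℤ, (x i - c).natAbs = 1 ∧
        (c - y i).natAbs + 1 = (x i - y i).natAbs := by
      rcases lt_or_gt_of_ne hi with h | h
      · exact ⟨x i + 1, by omega, by omega⟩
      · exact ⟨x i - 1, by omega, by omega⟩
    have hadj : (lattice d).Adj x (Function.update x i c) := by
      rw [adj_iff_dist1, dist1, Finset.sum_eq_single i]
      · simpa using hc1
      · intro j _ hj; simp [hj]
      · simp
    have hd : dist1 (Function.update x i c) y = k := by
      have e1 := Finset.add_sum_erase Finset.univ (fun j => (x j - y j).natAbs) (Finset.mem_univ i)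
      have e2 := Finset.add_sum_erase Finset.univ
        (fun j => (Function.update x i c j - y j).natAbs) (Finset.mem_univ i)
      have e3 : ∑ j ∈ Finset.univ.erase i, (Function.update x i c j - y j).natAbs
          = ∑ j ∈ Finset.univ.erase i, (x j - y j).natAbs :=
        Finset.sum_congr rfl fun j hj => by
          rw [Function.update_of_ne (Finset.ne_of_mem_erase hj)]
      simp only [Function.update_self] at e2
      unfold dist1 at hk ⊢
      omega
    obtain ⟨γ, hγ⟩ := ih _ hd
    exact ⟨.cons hadj γ, by simp [hγ]⟩

lemma dist1_le_length {x y : Fin d → ℤ} (γ : (lattice d).Walk x y) : dist1 x y ≤ γ.length := by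
  induction γ with
  | nil => simp [dist1_self]
  | cons h p ih =>
    rw [SimpleGraph.Walk.length_cons]
    have := dist1_triangle _ _ _ |>.trans (add_le_add (adj_iff_dist1.1 h).le ih)
    omega

variable {w : Edge d → ℝ} {x y z : Fin d → ℤ}

lemma pathWeight_nil : pathWeight w (.nil : (lattice d).Walk x x) = 0 := by simp [pathWeight]

lemma pathWeight_cons (h : (lattice d).Adj x y) (γ : (lattice d).Walk y z) :
    pathWeight w (.cons h γ) = w ⟨s(x, y), h⟩ + pathWeight w γ := by
  simp [pathWeight]

lemma pathWeight_append (γ : (lattice d).Walk x y) (γ' : (lattice d).Walk y z) :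
    pathWeight w (γ.append γ') = pathWeight w γ + pathWeight w γ' := by
  simp [pathWeight]

lemma pathWeight_le {b : ℝ} (hw : ∀ e, w e ≤ b) (γ : (lattice d).Walk x y) :
    pathWeight w γ ≤ b * γ.length := by
  induction γ with
  | nil => simp [pathWeight_nil]
  | cons h p ih =>
    rw [pathWeight_cons, SimpleGraph.Walk.length_cons]
    push_cast
    linarith [hw ⟨s(_, _), h⟩]

lemma le_pathWeight {a : ℝ} (hw : ∀ e, a ≤ w e) (γ : (lattice d).Walk x y) :
    a * γ.length ≤ pathWeight w γ := by
  induction γ with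
  | nil => simp [pathWeight_nil]
  | cons h p ih =>
    rw [pathWeight_cons, SimpleGraph.Walk.length_cons]
    push_cast
    linarith [hw ⟨s(_, _), h⟩]

lemma exists_walk_pathWeight_le {b : ℝ} (hw : ∀ e, w e ≤ b) (x y : Fin d → ℤ) :
    ∃ γ : (lattice d).Walk x y, pathWeight w γ ≤ b * dist1 x y := by
  obtain ⟨γ, hγ⟩ := exists_walk_length_eq_dist1 x y
  exact ⟨γ, hγ ▸ pathWeight_le hw γ⟩

/-- A path is a geodesic if no path with the same endpoints has a smaller weight. -/
def IsGeodesic (w : Edge d → ℝ) (γ : (lattice d).Walk x y) : Prop :=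
  ∀ γ' : (lattice d).Walk x y, pathWeight w γ ≤ pathWeight w γ'

lemma IsGeodesic.passageTime_eq {γ : (lattice d).Walk x y} (h : IsGeodesic w γ) :
    passageTime w x y = pathWeight w γ :=
  IsLeast.csInf_eq ⟨⟨γ, rfl⟩, by rintro _ ⟨γ', rfl⟩; exact h γ'⟩

lemma IsGeodesic.length_le {a b : ℝ} (hwa : ∀ e, a ≤ w e) (hwb : ∀ e, w e ≤ b)
    {γ : (lattice d).Walk x y} (h : IsGeodesic w γ) : a * γ.length ≤ b * dist1 x y := by
  obtain ⟨γ', h'⟩ := exists_walk_pathWeight_le hwb x y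
  exact (le_pathWeight hwa γ).trans ((h γ').trans h')

lemma passageTime_le {a : ℝ} (ha : 0 ≤ a) (hwa : ∀ e, a ≤ w e) (γ : (lattice d).Walk x y) :
    passageTime w x y ≤ pathWeight w γ :=
  ciInf_le ⟨0, by rintro _ ⟨γ', rfl⟩; exact le_trans (by positivity) (le_pathWeight hwa γ')⟩ γ

/-- The edges that belong to every geodesic from `x` to `y`. -/
def essential (w : Edge d → ℝ) (x y : Fin d → ℤ) : Set (Edge d) :=
  {e | ∀ γ : (lattice d).Walk x y, IsGeodesic w γ → e.1 ∈ γ.edges}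

lemma pathWeight_bypass_le {a : ℝ} (ha : 0 ≤ a) (hwa : ∀ e, a ≤ w e)
    (γ : (lattice d).Walk x y) : pathWeight w γ.bypass ≤ pathWeight w γ := by
  refine List.Sublist.sum_le_sum (γ.darts_bypass_sublist_darts.map _) fun c hc => ?_
  obtain ⟨s, _, rfl⟩ := List.mem_map.1 hc
  exact ha.trans (hwa _)

lemma IsGeodesic.bypass {a : ℝ} (ha : 0 ≤ a) (hwa : ∀ e, a ≤ w e)
    {γ : (lattice d).Walk x y} (h : IsGeodesic w γ) : IsGeodesic w γ.bypass :=
  fun γ' => (pathWeight_bypass_le ha hwa γ).trans (h γ')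

lemma pathWeight_take_add_drop (γ : (lattice d).Walk x y) (k : ℕ) :
    pathWeight w (γ.take k) + pathWeight w (γ.drop k) = pathWeight w γ := by
  rw [← pathWeight_append, SimpleGraph.Walk.append_take_drop_eq]

/-- The indices at which a geodesic visits two points at distance at most `R` differ by at most
`b R / a`. -/
lemma IsGeodesic.index_sub_le {a b : ℝ} (hwa : ∀ e, a ≤ w e) (hwb : ∀ e, w e ≤ b)
    {γ : (lattice d).Walk x y} (h : IsGeodesic w γ) {i j : ℕ} (hij : i ≤ j) (hj : j ≤ γ.length) :
    a * ((j : ℝ) - i) ≤ b * dist1 (γ.getVert i) (γ.getVert j) := by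
  -- replace the portion of `γ` between the two points by a shortest lattice path
  obtain ⟨p, hp⟩ := exists_walk_pathWeight_le hwb (γ.getVert i) (γ.getVert j)
  have h1 := h (((γ.take i).append p).append (γ.drop j))
  rw [pathWeight_append, pathWeight_append, ← pathWeight_take_add_drop γ j] at h1
  have h2 : pathWeight w (γ.take i) + a * ((j : ℝ) - i) ≤ pathWeight w (γ.take j) := by
    unfold pathWeight
    rw [SimpleGraph.Walk.darts_take, SimpleGraph.Walk.darts_take,
      ← List.take_append_drop i (γ.darts.take j), List.take_take, min_eq_left hij,
      List.map_append, List.sum_append]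
    have hlen : (((γ.darts.take j).drop i).map
        fun s => w ⟨s.edge, s.edge_mem⟩).length = j - i := by
      simp [hj]
    have := List.card_nsmul_le_sum (((γ.darts.take j).drop i).map
        fun s => w ⟨s.edge, s.edge_mem⟩) a (fun c hc => by
          obtain ⟨s, _, rfl⟩ := List.mem_map.1 hc
          exact hwa _)
    rw [hlen, nsmul_eq_mul, Nat.cast_sub hij] at this
    linarith
  linarith

/-- A geodesic spends little time in a set of small diameter. -/
lemma IsGeodesic.card_le {a b : ℝ} (ha : 0 < a) (hb : 0 ≤ b) (hwa : ∀ e, a ≤ w e)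
    (hwb : ∀ e, w e ≤ b)
    {γ : (lattice d).Walk x y} (h : IsGeodesic w γ) (D : Finset (Edge d)) {R : ℕ}
    (hD : ∀ e ∈ D, ∀ e' ∈ D, ∀ u ∈ e.1, ∀ v ∈ e'.1, dist1 u v ≤ R)
    (hγ : ∀ e ∈ D, e.1 ∈ γ.edges) : (D.card : ℝ) ≤ b * R / a + 1 := by
  rcases D.eq_empty_or_nonempty with rfl | hne
  · have : 0 ≤ b * R / a := by positivity
    simp only [Finset.card_empty, Nat.cast_zero]
    linarith
  let idx : Edge d → ℕ := fun e => γ.edges.idxOf e.1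
  have hlt : ∀ e ∈ D, idx e < γ.edges.length := fun e he => List.idxOf_lt_length_of_mem (hγ e he)
  have hinj : Set.InjOn idx D := fun e he e' he' hee => by
    have h1 := List.getElem_idxOf (hlt e he)
    have h2 := List.getElem_idxOf (hlt e' he')
    have hee' : γ.edges.idxOf e.1 = γ.edges.idxOf e'.1 := hee
    apply Subtype.ext
    rw [← h1, ← h2]
    simp only [hee']
  have hmem : ∀ e ∈ D, γ.getVert (idx e) ∈ e.1 := fun e he => by
    have h1 := List.getElem_idxOf (hlt e he)
    rw [SimpleGraph.Walk.getElem_edges] at h1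
    rw [← h1]
    exact Sym2.mem_mk_left _ _
  obtain ⟨e₀, he₀, hmin⟩ := D.exists_min_image idx hne
  have hle : ∀ e ∈ D, (idx e : ℝ) - idx e₀ ≤ b * R / a := fun e he => by
    have h1 := h.index_sub_le hwa hwb (hmin e he)
      (by have := hlt e he; rw [SimpleGraph.Walk.length_edges] at this; exact this.le)
    have h2 : (dist1 (γ.getVert (idx e₀)) (γ.getVert (idx e)) : ℝ) ≤ R := by
      exact_mod_cast hD e₀ he₀ e he _ (hmem e₀ he₀) _ (hmem e he)
    rw [le_div_iff₀ ha]
    nlinarith [mul_le_mul_of_nonneg_left h2 hb]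
  set L := ⌊b * R / a⌋₊
  have hsub : D.image idx ⊆ Finset.Icc (idx e₀) (idx e₀ + L) := fun k hk => by
    obtain ⟨e, he, rfl⟩ := Finset.mem_image.1 hk
    have h1 : idx e - idx e₀ ≤ L := Nat.le_floor (by
      rw [Nat.cast_sub (hmin e he)]; exact hle e he)
    have := hmin e he
    rw [Finset.mem_Icc]
    omega
  have hcard := Finset.card_le_card hsub
  rw [Finset.card_image_of_injOn hinj, Nat.card_Icc] at hcard
  have h0 : 0 ≤ b * R / a := by have := hle e₀ he₀; simpa using this
  have : (L : ℝ) ≤ b * R / a := Nat.floor_le h0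
  have h3 : (D.card : ℝ) ≤ L + 1 := by
    have : D.card ≤ L + 1 := by omega
    exact_mod_cast this
  linarith

/-- Passage times are Lipschitz functions of their endpoints. -/
lemma passageTime_le_add {a b : ℝ} (ha : 0 ≤ a) (hwa : ∀ e, a ≤ w e) (hwb : ∀ e, w e ≤ b)
    (x y x' y' : Fin d → ℤ) :
    passageTime w x y ≤ passageTime w x' y' + b * (dist1 x x' + dist1 y' y) := by
  obtain ⟨p, hp⟩ := exists_walk_pathWeight_le hwb x x'
  obtain ⟨q, hq⟩ := exists_walk_pathWeight_le hwb y' y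
  rw [← sub_le_iff_le_add]
  have : Nonempty ((lattice d).Walk x' y') := ⟨(exists_walk_length_eq_dist1 x' y').choose⟩
  refine le_ciInf fun γ => ?_
  have := passageTime_le ha hwa ((p.append γ).append q)
  rw [pathWeight_append, pathWeight_append] at this
  linarith

/-! ### Translations -/

/-- Translation by `z`, as an endomorphism of the lattice graph. -/
def shiftHom (z : Fin d → ℤ) : lattice d →g lattice d where
  toFun x := x + z
  map_rel' {x y} h := by rwa [adj_iff_dist1, dist1_add_right, ← adj_iff_dist1]

/-- Translation of edges by `z`. -/
def shiftEdge (z : Fin d → ℤ) (e : Edge d) : Edge d := (shiftHom z).mapEdgeSet e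

lemma shiftHom_apply (z x : Fin d → ℤ) : shiftHom z x = x + z := rfl

lemma coe_shiftEdge (z : Fin d → ℤ) (e : Edge d) :
    (shiftEdge z e).1 = Sym2.map (fun x => x + z) e.1 := rfl

lemma shiftEdge_shiftEdge_neg (z : Fin d → ℤ) (e : Edge d) :
    shiftEdge z (shiftEdge (-z) e) = e := by
  apply Subtype.ext
  rw [coe_shiftEdge, coe_shiftEdge, Sym2.map_map]
  simp

lemma shiftEdge_injective (z : Fin d → ℤ) : Function.Injective (shiftEdge z) := fun _ _ h =>
  Subtype.ext (Sym2.map.injective (add_left_injective z) (congrArg Subtype.val h))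

lemma pathWeight_map_shiftHom (z : Fin d → ℤ) (γ : (lattice d).Walk x y) :
    pathWeight w (γ.map (shiftHom z)) = pathWeight (fun e => w (shiftEdge z e)) γ := by
  induction γ with
  | nil => simp [pathWeight_nil]
  | cons h p ih =>
    rw [SimpleGraph.Walk.map_cons, pathWeight_cons, pathWeight_cons, ih]
    rfl

lemma pathWeight_copy {x' y' : Fin d → ℤ} (hx : x = x') (hy : y = y')
    (γ : (lattice d).Walk x y) : pathWeight w (γ.copy hx hy) = pathWeight w γ := by
  subst hx hy; rfl

lemma IsGeodesic.map_shiftHom {γ : (lattice d).Walk x y}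
    (h : IsGeodesic (fun e => w (shiftEdge z e)) γ) : IsGeodesic w (γ.map (shiftHom z)) := by
  intro γ'
  have hz : ∀ u : Fin d → ℤ, shiftHom (-z) (shiftHom z u) = u := fun u => by
    simp [shiftHom_apply]
  have h1 := h ((γ'.map (shiftHom (-z))).copy (hz x) (hz y))
  rw [pathWeight_copy, pathWeight_map_shiftHom] at h1
  simpa only [shiftEdge_shiftEdge_neg, pathWeight_map_shiftHom] using h1

lemma mem_essential_of_shiftEdge_mem {e : Edge d}
    (h : shiftEdge z e ∈ essential w (x + z) (y + z)) :
    e ∈ essential (fun e => w (shiftEdge z e)) x y := by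
  intro γ hγ
  have h1 : (shiftEdge z e).1 ∈ (γ.map (shiftHom z)).edges := h _ hγ.map_shiftHom
  rw [SimpleGraph.Walk.edges_map, List.mem_map] at h1
  obtain ⟨e', he', h2⟩ := h1
  rwa [← Sym2.map.injective (add_left_injective z) h2]

/-! ### Weights taking two values -/

variable {a b : ℝ}

/-- The weights given by a configuration of bits. -/
def bitWeight (a b : ℝ) (σ : Edge d → Bool) (e : Edge d) : ℝ := if σ e then b else a

lemma le_bitWeight (hab : a ≤ b) (σ : Edge d → Bool) (e : Edge d) : a ≤ bitWeight a b σ e := by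
  unfold bitWeight; split_ifs <;> linarith

lemma bitWeight_le (hab : a ≤ b) (σ : Edge d → Bool) (e : Edge d) : bitWeight a b σ e ≤ b := by
  unfold bitWeight; split_ifs <;> linarith

open Classical in
/-- The indicator that the edge `e` is essential from `x` to `y`. -/
noncomputable def essentialInd (a b : ℝ) (x y : Fin d → ℤ) (e : Edge d) (σ : Edge d → Bool) : ℝ :=
  if e ∈ essential (bitWeight a b σ) x y then 1 else 0

lemma essentialInd_nonneg (a b : ℝ) (x y : Fin d → ℤ) (e : Edge d) (σ : Edge d → Bool) :
    0 ≤ essentialInd a b x y e σ := by unfold essentialInd; split_ifs <;> norm_num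

lemma pathWeight_bitWeight_eq (σ : Edge d → Bool) (γ : (lattice d).Walk x y) :
    ∃ p q : ℕ, p + q = γ.length ∧ pathWeight (bitWeight a b σ) γ = a * p + b * q := by
  induction γ with
  | nil => exact ⟨0, 0, by simp [pathWeight_nil]⟩
  | cons h γ ih =>
    obtain ⟨p, q, h1, h2⟩ := ih
    by_cases hσ : σ ⟨s(_, _), h⟩ = true
    · refine ⟨p, q + 1, by rw [SimpleGraph.Walk.length_cons]; omega, ?_⟩
      rw [pathWeight_cons, h2, bitWeight, if_pos hσ]; push_cast; ring
    · refine ⟨p + 1, q, by rw [SimpleGraph.Walk.length_cons]; omega, ?_⟩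
      rw [pathWeight_cons, h2, bitWeight, if_neg hσ]; push_cast; ring

/-- Geodesics exist, since only finitely many numbers `a p + b q` are below a given bound. -/
lemma exists_isGeodesic (ha : 0 < a) (hab : a ≤ b) (σ : Edge d → Bool) (x y : Fin d → ℤ) :
    ∃ γ : (lattice d).Walk x y, IsGeodesic (bitWeight a b σ) γ := by
  obtain ⟨γ₀, -⟩ := exists_walk_length_eq_dist1 x y
  set M := pathWeight (bitWeight a b σ) γ₀
  let V : Set ℝ := {v | v ≤ M ∧ ∃ γ : (lattice d).Walk x y, pathWeight (bitWeight a b σ) γ = v}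
  have hV : V.Finite := by
    refine Set.Finite.subset (Finset.finite_toSet
      ((Finset.range (⌊M / a⌋₊ + 1) ×ˢ Finset.range (⌊M / a⌋₊ + 1)).image
        fun k : ℕ × ℕ => a * k.1 + b * k.2)) ?_
    rintro _ ⟨hv, γ, rfl⟩
    obtain ⟨p, q, h1, h2⟩ := pathWeight_bitWeight_eq (a := a) (b := b) σ γ
    have h3 : γ.length ≤ ⌊M / a⌋₊ := Nat.le_floor (by
      rw [le_div_iff₀ ha, mul_comm]
      exact (le_pathWeight (le_bitWeight hab σ) γ).trans hv)
    rw [h2]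
    simp only [Finset.coe_image, Set.mem_image, Finset.mem_coe, Finset.mem_product,
      Finset.mem_range]
    exact ⟨(p, q), ⟨by simp only; omega, by simp only; omega⟩, rfl⟩
  obtain ⟨v, ⟨hv, γ, rfl⟩, hmin⟩ := Set.exists_min_image V id hV ⟨M, le_rfl, γ₀, rfl⟩
  refine ⟨γ, fun γ' => ?_⟩
  rcases le_total (pathWeight (bitWeight a b σ) γ') M with h | h
  · exact hmin _ ⟨h, γ', rfl⟩
  · exact hv.trans h

lemma pathWeight_flip_le (hab : a ≤ b) (σ : Edge d → Bool) (e : Edge d)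
    (γ : (lattice d).Walk x y) :
    pathWeight (bitWeight a b (flip e σ)) γ
      ≤ pathWeight (bitWeight a b σ) γ + (b - a) * γ.edges.count e.1 := by
  induction γ with
  | nil => simp [pathWeight_nil]
  | cons h γ ih =>
    rw [pathWeight_cons, pathWeight_cons, SimpleGraph.Walk.edges_cons, List.count_cons]
    rename_i u v _
    by_cases he : (⟨s(u, v), h⟩ : Edge d) = e
    · have h1 := bitWeight_le hab (flip e σ) ⟨s(u, v), h⟩
      have h2 := le_bitWeight hab σ ⟨s(u, v), h⟩
      have he' : s(u, v) = e.1 := congrArg Subtype.val he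
      simp only [he', beq_self_eq_true, if_true]
      simp only [he'] at h1 h2
      push_cast
      linarith
    · have he' : s(u, v) ≠ e.1 := fun h' => he (Subtype.ext h')
      have h1 : bitWeight a b (flip e σ) ⟨s(u, v), h⟩ = bitWeight a b σ ⟨s(u, v), h⟩ := by
        unfold bitWeight; rw [flip_of_ne he]
      rw [h1, if_neg (by simpa using he')]
      push_cast
      linarith

/-- Changing the weight of an edge matters only if all geodesics use this edge, and then by at most
`b - a`, since geodesics may be taken self-avoiding. -/
lemma passageTime_flip_le (ha : 0 < a) (hab : a ≤ b) (σ : Edge d → Bool) (e : Edge d)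
    (x y : Fin d → ℤ) :
    passageTime (bitWeight a b (flip e σ)) x y ≤ passageTime (bitWeight a b σ) x y
      + (b - a) * essentialInd a b x y e σ := by
  unfold essentialInd
  split_ifs with he
  · obtain ⟨γ, hγ⟩ := exists_isGeodesic ha hab σ x y
    have hγ' := hγ.bypass ha.le (le_bitWeight hab σ)
    have h1 := pathWeight_flip_le hab σ e γ.bypass
    have h2 : (γ.bypass.edges.count e.1 : ℝ) ≤ 1 := by
      exact_mod_cast γ.bypass_isPath.isTrail.count_edges_le_one e.1
    have h3 := passageTime_le ha.le (le_bitWeight hab (flip e σ)) γ.bypass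
    rw [hγ'.passageTime_eq]
    have := mul_le_mul_of_nonneg_left h2 (sub_nonneg.2 hab)
    linarith
  · simp only [essential, Set.mem_ofPred_eq, not_forall] at he
    obtain ⟨γ, hγ, he⟩ := he
    have h1 := pathWeight_flip_le hab σ e γ
    rw [List.count_eq_zero_of_not_mem he] at h1
    have h3 := passageTime_le ha.le (le_bitWeight hab (flip e σ)) γ
    rw [hγ.passageTime_eq]
    push_cast at h1
    linarith

/-- The influence of an edge on the passage time, in terms of geodesics. -/
lemma abs_passageTime_sub_flip_le (ha : 0 < a) (hab : a ≤ b) (σ : Edge d → Bool) (e : Edge d)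
    (x y : Fin d → ℤ) :
    |passageTime (bitWeight a b σ) x y - passageTime (bitWeight a b (flip e σ)) x y|
      ≤ (b - a) * (essentialInd a b x y e σ + essentialInd a b x y e (flip e σ)) := by
  have h1 := passageTime_flip_le ha hab σ e x y
  have h2 := passageTime_flip_le ha hab (flip e σ) e x y
  rw [flip_flip] at h2
  have h3 : 0 ≤ (b - a) * essentialInd a b x y e σ :=
    mul_nonneg (sub_nonneg.2 hab) (essentialInd_nonneg ..)
  have h4 : 0 ≤ (b - a) * essentialInd a b x y e (flip e σ) :=
    mul_nonneg (sub_nonneg.2 hab) (essentialInd_nonneg ..)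
  rw [abs_le, mul_add]
  constructor <;> linarith

lemma abs_passageTime_sub_flip_le_sub (ha : 0 < a) (hab : a ≤ b) (σ : Edge d → Bool) (e : Edge d)
    (x y : Fin d → ℤ) :
    |passageTime (bitWeight a b σ) x y - passageTime (bitWeight a b (flip e σ)) x y| ≤ b - a := by
  have h1 := passageTime_flip_le ha hab σ e x y
  have h2 := passageTime_flip_le ha hab (flip e σ) e x y
  rw [flip_flip] at h2
  have h3 : ∀ τ : Edge d → Bool, (b - a) * essentialInd a b x y e τ ≤ b - a := fun τ => by
    unfold essentialInd
    split_ifs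
    · simp
    · simpa using hab
  rw [abs_le]
  constructor <;> linarith [h3 σ, h3 (flip e σ)]

/-- There are at most `b |x - y|₁ / a` essential edges. -/
lemma sum_essential_le (ha : 0 < a) (hab : a ≤ b) (σ : Edge d → Bool) (S : Finset (Edge d))
    (x y : Fin d → ℤ) :
    ∑ e ∈ S, essentialInd a b x y e σ
      ≤ b * dist1 x y / a := by
  obtain ⟨γ, hγ⟩ := exists_isGeodesic ha hab σ x y
  classical
  simp only [essentialInd]
  rw [Finset.sum_boole]
  have h1 : (S.filter (· ∈ essential (bitWeight a b σ) x y)).card ≤ γ.length := by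
    rw [← γ.length_edges]
    refine le_trans ?_ (List.toFinset_card_le γ.edges)
    refine Finset.card_le_card_of_injOn Subtype.val (fun e he => ?_)
      Subtype.val_injective.injOn
    simp only [Finset.coe_filter, Set.mem_ofPred_eq] at he
    simpa using he.2 γ hγ
  have h2 := hγ.length_le (le_bitWeight hab σ) (bitWeight_le hab σ)
  rw [le_div_iff₀ ha, mul_comm]
  exact (mul_le_mul_of_nonneg_left (by exact_mod_cast h1) ha.le).trans h2

/-- There are few essential edges in a set of small diameter. -/
lemma sum_essential_le_of_dist1_le (ha : 0 < a) (hab : a ≤ b) (σ : Edge d → Bool)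
    (D : Finset (Edge d)) {R : ℕ}
    (hD : ∀ e ∈ D, ∀ e' ∈ D, ∀ u ∈ e.1, ∀ v ∈ e'.1, dist1 u v ≤ R) (x y : Fin d → ℤ) :
    ∑ e ∈ D, essentialInd a b x y e σ
      ≤ b * R / a + 1 := by
  obtain ⟨γ, hγ⟩ := exists_isGeodesic ha hab σ x y
  classical
  simp only [essentialInd]
  rw [Finset.sum_boole]
  refine hγ.card_le ha (ha.le.trans hab) (le_bitWeight hab σ) (bitWeight_le hab σ) _ ?_ ?_
  · intro e he e' he'
    exact hD e (Finset.mem_filter.1 he).1 e' (Finset.mem_filter.1 he').1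
  · intro e he
    exact (Finset.mem_filter.1 he).2 γ hγ

lemma finite_setOf_dist1_le (x : Fin d → ℤ) (L : ℕ) : {v | dist1 x v ≤ L}.Finite := by
  refine (Set.finite_Icc (x - fun _ => (L : ℤ)) (x + fun _ => (L : ℤ))).subset fun v hv => ?_
  have h : ∀ i, (x i - v i).natAbs ≤ L := fun i =>
    (Finset.single_le_sum (f := fun i => (x i - v i).natAbs) (fun _ _ => Nat.zero_le _)
      (Finset.mem_univ i)).trans hv
  constructor <;> intro i <;> have := h i <;> simp <;> omega

/-- Walks of bounded length only see finitely many edges. -/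
lemma exists_finset_edges (x : Fin d → ℤ) (L : ℕ) :
    ∃ S : Finset (Edge d), ∀ (w w' : Edge d → ℝ), (∀ e ∈ S, w e = w' e) →
      ∀ (y : Fin d → ℤ) (γ : (lattice d).Walk x y), γ.length ≤ L →
        pathWeight w γ = pathWeight w' γ := by
  classical
  have hfin : {e : Edge d | e.1 ∈ (finite_setOf_dist1_le x L).toFinset.sym2}.Finite :=
    (Finset.finite_toSet (finite_setOf_dist1_le x L).toFinset.sym2).preimage
      Subtype.val_injective.injOn
  refine ⟨hfin.toFinset, fun w w' hw y γ hγ => ?_⟩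
  unfold pathWeight
  congr 1
  refine List.map_congr_left fun s hs => hw _ ?_
  rw [Set.Finite.mem_toFinset, Set.mem_ofPred_eq, Finset.mem_sym2_iff]
  intro v hv
  rw [Set.Finite.mem_toFinset, Set.mem_ofPred_eq]
  have hv' : v ∈ γ.support :=
    γ.mem_support_of_mem_edges (List.mem_map_of_mem (f := SimpleGraph.Dart.edge) hs) hv
  exact ((dist1_le_length (γ.takeUntil v hv')).trans (γ.length_takeUntil_le_length hv')).trans hγ

/-- Passage times and essential edges depend on finitely many weights only. -/
lemma exists_finset_passageTime_eq (ha : 0 < a) (hab : a ≤ b) (x y : Fin d → ℤ) :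
    ∃ S : Finset (Edge d), ∀ σ σ' : Edge d → Bool, (∀ e ∈ S, σ e = σ' e) →
      passageTime (bitWeight a b σ) x y = passageTime (bitWeight a b σ') x y ∧
      essential (bitWeight a b σ) x y = essential (bitWeight a b σ') x y := by
  set L := ⌊b * dist1 x y / a⌋₊
  obtain ⟨S, hS⟩ := exists_finset_edges x L
  refine ⟨S, fun σ σ' h => ?_⟩
  have key : ∀ τ τ' : Edge d → Bool, (∀ e ∈ S, τ e = τ' e) → ∀ γ : (lattice d).Walk x y,
      IsGeodesic (bitWeight a b τ) γ → IsGeodesic (bitWeight a b τ') γ ∧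
        pathWeight (bitWeight a b τ) γ = pathWeight (bitWeight a b τ') γ := by
    intro τ τ' hτ γ hγ
    have hw := hS (bitWeight a b τ) (bitWeight a b τ') (fun e he => by simp [bitWeight, hτ e he])
    have hlen : ∀ (τ : Edge d → Bool) (γ : (lattice d).Walk x y),
        IsGeodesic (bitWeight a b τ) γ → γ.length ≤ L := fun τ γ hγ => by
      refine Nat.le_floor ?_
      rw [le_div_iff₀ ha, mul_comm]
      exact hγ.length_le (le_bitWeight hab τ) (bitWeight_le hab τ)
    obtain ⟨γ₁, h₁⟩ := exists_isGeodesic ha hab τ' x y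
    refine ⟨fun γ' => ?_, hw y γ (hlen τ γ hγ)⟩
    calc pathWeight (bitWeight a b τ') γ = pathWeight (bitWeight a b τ) γ :=
          (hw y γ (hlen τ γ hγ)).symm
      _ ≤ pathWeight (bitWeight a b τ) γ₁ := hγ γ₁
      _ = pathWeight (bitWeight a b τ') γ₁ := hw y γ₁ (hlen τ' γ₁ h₁)
      _ ≤ _ := h₁ γ'
  have h' : ∀ e ∈ S, σ' e = σ e := fun e he => (h e he).symm
  constructor
  · obtain ⟨γ, hγ⟩ := exists_isGeodesic ha hab σ x y
    rw [hγ.passageTime_eq, (key σ σ' h γ hγ).1.passageTime_eq, (key σ σ' h γ hγ).2]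
  · ext e
    exact ⟨fun he γ hγ => he γ (key σ' σ h' γ hγ).1, fun he γ hγ => he γ (key σ σ' h γ hγ).1⟩

end Lattice

/-! ### Families of fair bits -/

section Bits

variable {ι : Type*} {Ω : Type*} [MeasurableSpace Ω]

/-- The bits `X i` are independent and uniformly distributed. -/
structure IsFairBits (X : ι → Ω → Bool) (P : Measure Ω) : Prop where
  measurable : ∀ i, Measurable (X i)
  indep : iIndepFun X P
  half : ∀ i c, P (X i ⁻¹' {c}) = 2⁻¹

lemma IsFairBits.precomp {κ : Type*} {X : ι → Ω → Bool} {P : Measure Ω} (h : IsFairBits X P)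
    {g : κ → ι} (hg : Function.Injective g) : IsFairBits (fun k => X (g k)) P :=
  ⟨fun _ => h.measurable _, h.indep.precomp hg, fun _ c => h.half _ c⟩

variable [DecidableEq ι]

/-- Extends a configuration on `S` to all coordinates; the values outside `S` are irrelevant for
functions that depend on `S` only. -/
def extend (S : Finset ι) (y : S → Bool) (i : ι) : Bool :=
  if h : i ∈ S then y ⟨i, h⟩ else true

lemma extend_flip (S : Finset ι) (i : S) (y : S → Bool) :
    extend S (flip i y) = flip i.1 (extend S y) := by
  ext j
  by_cases hj : j = i.1
  · subst hj
    simp [extend]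
  · rw [flip_of_ne hj]
    unfold extend
    split_ifs with h
    · rw [flip_of_ne (fun h' => hj (congrArg Subtype.val h'))]
    · rfl

lemma _root_.DependsOn.apply_extend {f : (ι → Bool) → ℝ} {S : Finset ι} (hf : DependsOn f S)
    (σ : ι → Bool) : f (extend S fun i => σ i) = f σ :=
  hf fun i hi => by
    have : i ∈ S := hi
    simp [extend, this]

variable {X : ι → Ω → Bool} {P : Measure Ω}

lemma IsFairBits.measurable_comp (h : IsFairBits X P) {f : (ι → Bool) → ℝ} {S : Finset ι}
    (hf : DependsOn f S) : Measurable fun ω => f fun i => X i ω := by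
  have h1 : (fun ω => f fun i => X i ω)
      = (fun y : S → Bool => f (extend S y)) ∘ fun ω (i : S) => X i ω := by
    ext ω
    exact (hf.apply_extend fun i => X i ω).symm
  rw [h1]
  exact (measurable_of_finite _).comp (measurable_pi_lambda _ fun i => h.measurable _)

variable [IsProbabilityMeasure P]

lemma IsFairBits.integral_eq_avg (h : IsFairBits X P) {f : (ι → Bool) → ℝ} {S : Finset ι}
    (hf : DependsOn f S) :
    ∫ ω, f (fun i => X i ω) ∂P = avg fun y : S → Bool => f (extend S y) := by
  have hS := h.precomp (g := fun i : S => i.1) Subtype.val_injective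
  have hm : Measurable fun ω (i : S) => X i ω := measurable_pi_lambda _ fun i => h.measurable _
  have hlaw : ∀ y : S → Bool, (P.map fun ω (i : S) => X i ω).real {y}
      = 1 / 2 ^ Fintype.card S := fun y => by
    rw [(iIndepFun_iff_map_fun_eq_pi_map fun i => (hS.measurable i).aemeasurable).1 hS.indep,
      measureReal_def]
    have : ∀ i : S, IsProbabilityMeasure (P.map (X i)) := fun i =>
      Measure.isProbabilityMeasure_map (h.measurable _).aemeasurable
    rw [Measure.pi_singleton]
    have h2 : ∀ i : S, (P.map (X i)) {y i} = 2⁻¹ := fun i => by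
      rw [Measure.map_apply (h.measurable _) (measurableSet_singleton _), h.half]
    simp [h2]
  have hmap : IsProbabilityMeasure (P.map fun ω (i : S) => X i ω) :=
    Measure.isProbabilityMeasure_map hm.aemeasurable
  calc ∫ ω, f (fun i => X i ω) ∂P
      = ∫ ω, (fun y : S → Bool => f (extend S y)) (fun i : S => X i ω) ∂P :=
        integral_congr_ae (Filter.Eventually.of_forall fun ω =>
          (hf.apply_extend fun i => X i ω).symm)
    _ = ∫ y, f (extend S y) ∂(P.map fun ω (i : S) => X i ω) :=
        (integral_map (f := fun y : S → Bool => f (extend S y)) hm.aemeasurable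
          (measurable_of_finite _).aestronglyMeasurable).symm
    _ = avg fun y : S → Bool => f (extend S y) := by
        rw [integral_fintype .of_finite]
        simp only [hlaw, smul_eq_mul, avg, ← Finset.mul_sum]
        ring

lemma IsFairBits.memLp (h : IsFairBits X P) {f : (ι → Bool) → ℝ} {S : Finset ι}
    (hf : DependsOn f S) (p : ℝ≥0∞) : MemLp (fun ω => f fun i => X i ω) p P := by
  refine MemLp.of_bound (h.measurable_comp hf).aestronglyMeasurable
    (∑ y : S → Bool, |f (extend S y)|) (Filter.Eventually.of_forall fun ω => ?_)
  rw [← hf.apply_extend, Real.norm_eq_abs]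
  exact Finset.single_le_sum (f := fun y : S → Bool => |f (extend S y)|)
    (fun _ _ => abs_nonneg _) (Finset.mem_univ _)

lemma IsFairBits.integrable (h : IsFairBits X P) {f : (ι → Bool) → ℝ} {S : Finset ι}
    (hf : DependsOn f S) : Integrable (fun ω => f fun i => X i ω) P :=
  memLp_one_iff_integrable.1 (h.memLp hf 1)

lemma IsFairBits.variance_eq_avg (h : IsFairBits X P) {f : (ι → Bool) → ℝ} {S : Finset ι}
    (hf : DependsOn f S) : Var[fun ω => f fun i => X i ω; P]
      = avg (fun y : S → Bool => f (extend S y) ^ 2)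
        - avg (fun y : S → Bool => f (extend S y)) ^ 2 := by
  rw [variance_eq_sub (h.memLp hf 2), h.integral_eq_avg hf]
  congr 1
  exact h.integral_eq_avg (f := fun σ => f σ ^ 2) fun σ σ' hσ => by simp only [hf hσ]

end Bits

section Comparison

variable {ι : Type*} [DecidableEq ι] [Fintype ι]

/-- A perturbation of size `M` changes the variance in a controlled way. -/
lemma avg_sq_sub_sq_avg_le_of_abs_sub_le (f g : (ι → Bool) → ℝ) {M : ℝ}
    (hM : ∀ x, |f x - g x| ≤ M) :
    avg (fun x => f x ^ 2) - avg f ^ 2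
      ≤ 2 * (avg (fun x => g x ^ 2) - avg g ^ 2) + 2 * M ^ 2 := by
  set c := avg g with hc
  have hexp : ∀ u : (ι → Bool) → ℝ,
      avg (fun x => (u x - c) ^ 2) = avg (fun x => u x ^ 2) - 2 * c * avg u + c ^ 2 := fun u => by
    rw [← avg_const (ι := ι) (c ^ 2), ← avg_const_mul, ← avg_sub, ← avg_add]
    congr 1; ext x; ring
  have h1 : avg (fun x => (f x - c) ^ 2) ≤ avg (fun x => 2 * (g x - c) ^ 2 + 2 * M ^ 2) := by
    refine avg_mono fun x => ?_
    have h2 : (f x - g x) ^ 2 ≤ M ^ 2 := sq_le_sq' (by linarith [(abs_le.1 (hM x)).1])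
      (abs_le.1 (hM x)).2
    nlinarith [sq_nonneg (f x - g x - (g x - c))]
  rw [avg_add, avg_const_mul, avg_const, hexp, hexp, ← hc] at h1
  nlinarith [sq_nonneg (avg f - c)]

/-- The variance inequality when the influences of `f` are bounded by `D`, have small means `q i`,
and these means have a small sum. -/
lemma avg_sq_sub_sq_avg_le_of_influence_le (f : (ι → Bool) → ℝ) {K : ℕ} (hK : 0 < K) {D Q s : ℝ}
    (hD : 0 ≤ D) (q : ι → ℝ) (hf : ∀ i x, |influence i f x| ≤ D)
    (hq : ∀ i, avg (fun x => |influence i f x|) ≤ D * q i) (hqQ : ∀ i, q i ≤ Q)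
    (hq0 : ∀ i, 0 ≤ q i) (hs : ∑ i, q i ≤ s) :
    avg (fun x => f x ^ 2) - avg f ^ 2 ≤ D ^ 2 * (3 ^ K * √Q + 1 / K) * s := by
  have hKr : (0 : ℝ) < K := by exact_mod_cast hK
  refine (avg_sq_sub_sq_avg_le f hK).trans ?_
  have hterm : ∀ i, (3 ^ K * (avg (fun x => |influence i f x|) *
      √(avg (fun x => influence i f x ^ 2))) + avg (fun x => influence i f x ^ 2) / K)
      ≤ D ^ 2 * (3 ^ K * √Q + 1 / K) * q i := fun i => by
    have h2 : avg (fun x => influence i f x ^ 2) ≤ D ^ 2 * q i := by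
      calc avg (fun x => influence i f x ^ 2) ≤ avg (fun x => D * |influence i f x|) := by
            refine avg_mono fun x => ?_
            rw [← sq_abs, sq]
            exact mul_le_mul_of_nonneg_right (hf i x) (abs_nonneg _)
        _ = D * avg (fun x => |influence i f x|) := avg_const_mul _ _
        _ ≤ D * (D * q i) := mul_le_mul_of_nonneg_left (hq i) hD
        _ = _ := by ring
    have h3 : √(avg (fun x => influence i f x ^ 2)) ≤ D * √Q := by
      have h4 : D * √Q = √(D ^ 2 * Q) := by rw [Real.sqrt_mul (sq_nonneg D), Real.sqrt_sq hD]
      rw [h4]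
      exact Real.sqrt_le_sqrt (h2.trans (mul_le_mul_of_nonneg_left (hqQ i) (sq_nonneg D)))
    calc _ ≤ 3 ^ K * ((D * q i) * (D * √Q)) + D ^ 2 * q i / K := by
          gcongr
          · exact mul_nonneg hD (hq0 i)
          · exact hq i
      _ = _ := by ring
  refine (Finset.sum_le_sum fun i _ => hterm i).trans ?_
  rw [← Finset.mul_sum]
  gcongr

end Comparison

/-! ### Spatial averaging -/

section Averaging

variable {d : ℕ}

/-- The cube `{0, …, m - 1}^d`. -/
noncomputable def box (d m : ℕ) : Finset (Fin d → ℤ) :=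
  Fintype.piFinset fun _ => Finset.Ico 0 (m : ℤ)

lemma card_box (d m : ℕ) : (box d m).card = m ^ d := by simp [box]

lemma dist1_le_of_mem_box {m : ℕ} {z z' : Fin d → ℤ} (hz : z ∈ box d m) (hz' : z' ∈ box d m) :
    dist1 z z' ≤ d * m := by
  have h : ∀ i, (z i - z' i).natAbs ≤ m := fun i => by
    have h1 := Finset.mem_Ico.1 (Fintype.mem_piFinset.1 hz i)
    have h2 := Finset.mem_Ico.1 (Fintype.mem_piFinset.1 hz' i)
    omega
  exact (Finset.sum_le_card_nsmul _ _ m fun i _ => h i).trans (by simp)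

lemma dist1_add_left (x y z : Fin d → ℤ) : dist1 (z + x) (z + y) = dist1 x y := by
  simp [dist1]

lemma dist1_le_one_of_mem {e : Edge d} {u v : Fin d → ℤ} (hu : u ∈ e.1) (hv : v ∈ e.1) :
    dist1 u v ≤ 1 := by
  by_cases huv : u = v
  · rw [huv, dist1_self]; exact Nat.zero_le _
  · have h : e.1 = s(u, v) := (Sym2.mem_and_mem_iff huv).1 ⟨hu, hv⟩
    have h2 := e.2
    rw [h, SimpleGraph.mem_edgeSet, adj_iff_dist1] at h2
    exact h2.le

lemma shiftEdge_neg_injective (e : Edge d) : Function.Injective fun z => shiftEdge (-z) e := by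
  intro z z' h
  have h1 : Sym2.map (fun x => x + -z) e.1 = Sym2.map (fun x => x + -z') e.1 :=
    congrArg Subtype.val h
  revert h1
  induction e.1 using Sym2.ind with
  | _ u v =>
    intro h1
    simp only [Sym2.map_mk, Sym2.eq_iff] at h1
    rcases h1 with ⟨h2, _⟩ | ⟨h2, h3⟩
    · exact neg_injective (add_left_cancel h2)
    · -- the endpoints are exchanged: add the two equations
      ext i
      have e2 := congrFun h2 i
      have e3 := congrFun h3 i
      simp only [Pi.add_apply, Pi.neg_apply] at e2 e3
      omega

/-- The translates of an edge by `-z`, `z ∈ box d m`, lie close together. -/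
lemma dist1_le_of_mem_shiftEdge_neg {m : ℕ} {e : Edge d} {z z' u v : Fin d → ℤ}
    (hz : z ∈ box d m) (hz' : z' ∈ box d m) (hu : u ∈ (shiftEdge (-z) e).1)
    (hv : v ∈ (shiftEdge (-z') e).1) : dist1 u v ≤ d * m + 1 := by
  rw [coe_shiftEdge, Sym2.mem_map] at hu hv
  obtain ⟨u₀, hu₀, rfl⟩ := hu
  obtain ⟨v₀, hv₀, rfl⟩ := hv
  have h1 := dist1_triangle (u₀ + -z) (v₀ + -z) (v₀ + -z')
  have h2 : dist1 (-z) (-z') = dist1 z z' :=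
    Finset.sum_congr rfl fun i _ => by simp only [Pi.neg_apply]; omega
  rw [dist1_add_right, dist1_add_left, h2] at h1
  have h3 := dist1_le_one_of_mem hu₀ hv₀
  have h4 := dist1_le_of_mem_box hz hz'
  omega

/-- The mean of the passage times between the translates of `x` and `y` by the points of a box. -/
noncomputable def averagedTime (a b : ℝ) (m : ℕ) (x y : Fin d → ℤ) (σ : Edge d → Bool) : ℝ :=
  (∑ z ∈ box d m, passageTime (bitWeight a b σ) (x + z) (y + z)) / (m : ℝ) ^ d

variable {a b : ℝ} {m : ℕ}

/-- Averaging over a box of side `m` changes the passage time by `O(m)`. -/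
lemma abs_passageTime_sub_averagedTime_le (ha : 0 < a) (hab : a ≤ b) (hm : 0 < m)
    (x y : Fin d → ℤ) (σ : Edge d → Bool) :
    |passageTime (bitWeight a b σ) x y - averagedTime a b m x y σ| ≤ 2 * b * (d * m) := by
  have hmr : (0 : ℝ) < (m : ℝ) ^ d := by positivity
  have hb : 0 ≤ b := ha.le.trans hab
  have hz : ∀ z ∈ box d m, |passageTime (bitWeight a b σ) x y
      - passageTime (bitWeight a b σ) (x + z) (y + z)| ≤ 2 * b * (d * m) := fun z hz => by
    have h0 : (0 : Fin d → ℤ) ∈ box d m :=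
      Fintype.mem_piFinset.2 fun i => Finset.mem_Ico.2 ⟨le_rfl, by simpa using hm⟩
    have hd : ∀ u : Fin d → ℤ, (dist1 u (u + z) : ℝ) ≤ d * m := fun u => by
      have h1 := dist1_add_left 0 z u
      rw [add_zero] at h1
      rw [h1]
      exact_mod_cast dist1_le_of_mem_box h0 hz
    have h1 := passageTime_le_add ha.le (le_bitWeight hab σ) (bitWeight_le hab σ) x y
      (x + z) (y + z)
    have h2 := passageTime_le_add ha.le (le_bitWeight hab σ) (bitWeight_le hab σ)
      (x + z) (y + z) x y
    rw [dist1_comm (y + z) y] at h1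
    rw [dist1_comm (x + z) x] at h2
    have h3 : b * ((dist1 x (x + z) : ℝ) + dist1 y (y + z)) ≤ b * (d * m + d * m) :=
      mul_le_mul_of_nonneg_left (add_le_add (hd x) (hd y)) hb
    rw [abs_le]
    constructor <;> linarith
  have heq : passageTime (bitWeight a b σ) x y - averagedTime a b m x y σ
      = (∑ z ∈ box d m, (passageTime (bitWeight a b σ) x y
          - passageTime (bitWeight a b σ) (x + z) (y + z))) / (m : ℝ) ^ d := by
    rw [Finset.sum_sub_distrib, Finset.sum_const, card_box, averagedTime, nsmul_eq_mul]
    push_cast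
    field_simp
  rw [heq, abs_div, abs_of_pos hmr, div_le_iff₀ hmr]
  calc _ ≤ ∑ z ∈ box d m, |passageTime (bitWeight a b σ) x y
          - passageTime (bitWeight a b σ) (x + z) (y + z)| := Finset.abs_sum_le_sum_abs _ _
    _ ≤ (box d m).card • (2 * b * (d * m)) := Finset.sum_le_card_nsmul _ _ _ hz
    _ = _ := by rw [card_box, nsmul_eq_mul]; push_cast; ring

lemma abs_influence_averagedTime_le_div (x y : Fin d → ℤ)
    (e : Edge d) (σ : Edge d → Bool) :
    |influence e (averagedTime a b m x y) σ|
      ≤ (∑ z ∈ box d m, |passageTime (bitWeight a b σ) (x + z) (y + z)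
          - passageTime (bitWeight a b (flip e σ)) (x + z) (y + z)|) / (m : ℝ) ^ d / 2 := by
  rw [influence, averagedTime, averagedTime, ← sub_div, ← Finset.sum_sub_distrib, abs_div, abs_div,
    abs_of_nonneg (by positivity : (0 : ℝ) ≤ (m : ℝ) ^ d), abs_two]
  gcongr
  exact Finset.abs_sum_le_sum_abs _ _

lemma abs_influence_averagedTime_le_sub (ha : 0 < a) (hab : a ≤ b) (hm : 0 < m)
    (x y : Fin d → ℤ) (e : Edge d) (σ : Edge d → Bool) :
    |influence e (averagedTime a b m x y) σ| ≤ b - a := by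
  refine (abs_influence_averagedTime_le_div x y e σ).trans ?_
  have hmr : (0 : ℝ) < (m : ℝ) ^ d := by positivity
  have h : ∑ z ∈ box d m, |passageTime (bitWeight a b σ) (x + z) (y + z)
          - passageTime (bitWeight a b (flip e σ)) (x + z) (y + z)| ≤ (m : ℝ) ^ d * (b - a) := by
    refine (Finset.sum_le_card_nsmul _ _ (b - a) fun z _ => ?_).trans ?_
    · exact abs_passageTime_sub_flip_le_sub ha hab σ e (x + z) (y + z)
    · rw [card_box, nsmul_eq_mul]; push_cast; exact le_rfl
  rw [div_div, div_le_iff₀ (by positivity)]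
  nlinarith [mul_nonneg hmr.le (sub_nonneg.2 hab)]

lemma abs_influence_averagedTime_le (ha : 0 < a) (hab : a ≤ b)
    (x y : Fin d → ℤ) (e : Edge d) (σ : Edge d → Bool) :
    |influence e (averagedTime a b m x y) σ|
      ≤ (b - a) / (2 * (m : ℝ) ^ d) * ∑ z ∈ box d m, (essentialInd a b (x + z) (y + z) e σ
        + essentialInd a b (x + z) (y + z) e (flip e σ)) := by
  refine (abs_influence_averagedTime_le_div x y e σ).trans ?_
  rw [div_div, mul_comm _ (2 : ℝ), div_mul_eq_mul_div, Finset.mul_sum]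
  gcongr with z
  exact abs_passageTime_sub_flip_le ha hab σ e (x + z) (y + z)

/-- The variance bound obtained by applying the cube inequality to the averaged passage time.
The box of side `m` makes every influence at most of order `m ^ (1 - d)`, because a geodesic
meets a box of side `m` in `O(m)` edges only. -/
theorem variance_passageTime_le {Ω : Type*} [MeasurableSpace Ω] {P : Measure Ω}
    [IsProbabilityMeasure P] {X : Edge d → Ω → Bool} (hX : IsFairBits X P) (ha : 0 < a)
    (hab : a ≤ b) (hm : 0 < m) {K : ℕ} (hK : 0 < K) (x y : Fin d → ℤ) :
    MemLp (fun ω => passageTime (bitWeight a b fun e => X e ω) x y) 2 P ∧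
    Var[fun ω => passageTime (bitWeight a b fun e => X e ω) x y; P]
      ≤ 2 * ((b - a) ^ 2 * (3 ^ K * √((b * (d * m + 1) / a + 1) / (m : ℝ) ^ d) + 1 / K)
          * (b * dist1 x y / a)) + 2 * (2 * b * (d * m)) ^ 2 := by
  classical
  have hmr : (0 : ℝ) < (m : ℝ) ^ d := by positivity
  choose S' hS' using fun z : Fin d → ℤ => exists_finset_passageTime_eq ha hab (x + z) (y + z)
  obtain ⟨S₀, hS₀⟩ := exists_finset_passageTime_eq ha hab x y
  set S : Finset (Edge d) := S₀ ∪ (box d m).biUnion S' with hSdef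
  have hS : ∀ z ∈ box d m, ∀ σ σ' : Edge d → Bool, (∀ e ∈ S, σ e = σ' e) →
      passageTime (bitWeight a b σ) (x + z) (y + z) = passageTime (bitWeight a b σ') (x + z) (y + z)
      ∧ essential (bitWeight a b σ) (x + z) (y + z)
        = essential (bitWeight a b σ') (x + z) (y + z) := fun z hz σ σ' h =>
    hS' z σ σ' fun e he => h e (Finset.mem_union_right _ (Finset.mem_biUnion.2 ⟨z, hz, he⟩))
  have hT : DependsOn (fun σ => passageTime (bitWeight a b σ) x y) (S : Set (Edge d)) :=
    fun σ σ' h => (hS₀ σ σ' fun e he => h e (Finset.mem_union_left _ he)).1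
  have hI₀ : ∀ e, DependsOn (essentialInd a b x y e) (S : Set (Edge d)) := fun e σ σ' h => by
    simp only [essentialInd, (hS₀ σ σ' fun e he => h e (Finset.mem_union_left _ he)).2]
  have hI : ∀ z ∈ box d m, ∀ e,
      DependsOn (essentialInd a b (x + z) (y + z) e) (S : Set (Edge d)) := fun z hz e σ σ' h => by
    simp only [essentialInd, (hS z hz σ σ' h).2]
  refine ⟨hX.memLp hT 2, ?_⟩
  rw [hX.variance_eq_avg hT]
  refine (avg_sq_sub_sq_avg_le_of_abs_sub_le _
    (fun η : S → Bool => averagedTime a b m x y (extend S η))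
    fun η => abs_passageTime_sub_averagedTime_le ha hab hm x y _).trans ?_
  gcongr 2 * ?_ + _
  -- `q e` is the mean over the box of the probabilities that `e` is essential
  set q : S → ℝ := fun e => (∑ z ∈ box d m,
    ∫ ω, essentialInd a b (x + z) (y + z) e.1 (fun e => X e ω) ∂P) / (m : ℝ) ^ d with hq
  have hinf : ∀ (e : S) (η : S → Bool),
      influence e (fun η : S → Bool => averagedTime a b m x y (extend S η)) η
        = influence e.1 (averagedTime a b m x y) (extend S η) := fun e η => by
    simp only [influence, extend_flip]
  refine avg_sq_sub_sq_avg_le_of_influence_le _ hK (sub_nonneg.2 hab) q ?_ ?_ ?_ ?_ ?_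
  · intro e η
    rw [hinf]
    exact abs_influence_averagedTime_le_sub ha hab hm x y _ _
  · intro e
    have h1 : avg (fun η : S → Bool =>
        |influence e (fun η : S → Bool => averagedTime a b m x y (extend S η)) η|)
        ≤ avg (fun η : S → Bool => (b - a) / (2 * (m : ℝ) ^ d) *
          ∑ z ∈ box d m, (essentialInd a b (x + z) (y + z) e.1 (extend S η)
            + essentialInd a b (x + z) (y + z) e.1 (extend S (flip e η)))) := by
      refine avg_mono fun η => ?_
      rw [hinf, extend_flip]
      exact abs_influence_averagedTime_le ha hab x y _ _
    refine h1.trans (le_of_eq ?_)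
    rw [avg_const_mul, avg_sum]
    have h2 : ∀ z ∈ box d m, avg (fun η : S → Bool =>
        essentialInd a b (x + z) (y + z) e.1 (extend S η)
          + essentialInd a b (x + z) (y + z) e.1 (extend S (flip e η)))
        = 2 * ∫ ω, essentialInd a b (x + z) (y + z) e.1 (fun e => X e ω) ∂P := fun z hz => by
      rw [avg_add, avg_flip e fun η : S → Bool => essentialInd a b (x + z) (y + z) e.1 (extend S η),
        hX.integral_eq_avg (hI z hz e.1)]
      ring
    rw [Finset.sum_congr rfl h2, ← Finset.mul_sum, hq]
    field_simp
  · intro e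
    refine div_le_div_of_nonneg_right ?_ hmr.le
    -- translate each configuration by `z`, so that the endpoints become `x` and `y`
    have h1 : ∀ z ∈ box d m, ∫ ω, essentialInd a b (x + z) (y + z) e.1 (fun e => X e ω) ∂P
        ≤ ∫ ω, essentialInd a b x y (shiftEdge (-z) e.1) (fun e => X e ω) ∂P := fun z hz => by
      have hXz := hX.precomp (shiftEdge_injective z)
      rw [hX.integral_eq_avg (hI₀ _), ← hXz.integral_eq_avg (hI₀ _)]
      refine integral_mono (hX.integrable (hI z hz e.1)) (hXz.integrable (hI₀ _)) fun ω => ?_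
      simp only [essentialInd]
      split_ifs with h h' h'
      · exact le_rfl
      · refine absurd ?_ h'
        rw [← shiftEdge_shiftEdge_neg z e.1] at h
        exact mem_essential_of_shiftEdge_mem h
      · exact zero_le_one
      · exact le_rfl
    refine (Finset.sum_le_sum h1).trans ?_
    rw [← integral_finsetSum _ fun z _ => hX.integrable (hI₀ _)]
    have h2 : ∀ ω, ∑ z ∈ box d m, essentialInd a b x y (shiftEdge (-z) e.1) (fun e => X e ω)
        ≤ b * (d * m + 1) / a + 1 := fun ω => by
      have h3 := sum_essential_le_of_dist1_le ha hab (fun e => X e ω)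
        ((box d m).image fun z => shiftEdge (-z) e.1) (R := d * m + 1) (by
          intro e₁ h₁ e₂ h₂ u hu v hv
          obtain ⟨z₁, hz₁, rfl⟩ := Finset.mem_image.1 h₁
          obtain ⟨z₂, hz₂, rfl⟩ := Finset.mem_image.1 h₂
          exact dist1_le_of_mem_shiftEdge_neg hz₁ hz₂ hu hv) x y
      rw [Finset.sum_image fun _ _ _ _ h => shiftEdge_neg_injective e.1 h] at h3
      push_cast at h3
      exact h3
    calc _ ≤ ∫ _ω, (b * (d * m + 1) / a + 1) ∂P :=
          integral_mono (integrable_finsetSum _ fun z _ => hX.integrable (hI₀ _))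
            (integrable_const _) h2
      _ = _ := by simp
  · intro e
    exact div_nonneg (Finset.sum_nonneg fun z _ =>
      integral_nonneg fun ω => essentialInd_nonneg _ _ _ _ _ _) hmr.le
  · rw [hq, ← Finset.sum_div, Finset.sum_comm, div_le_iff₀ hmr]
    have h1 : ∀ z ∈ box d m, ∑ e : S, ∫ ω, essentialInd a b (x + z) (y + z) e.1 (fun e => X e ω) ∂P
        ≤ b * dist1 x y / a := fun z hz => by
      rw [← integral_finsetSum _ fun e _ => hX.integrable (hI z hz _)]
      calc _ ≤ ∫ _ω, (b * dist1 x y / a) ∂P := by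
            refine integral_mono (integrable_finsetSum _ fun e _ => hX.integrable (hI z hz _))
              (integrable_const _) fun ω => ?_
            have := sum_essential_le ha hab (fun e => X e ω) S (x + z) (y + z)
            rw [dist1_add_right, ← Finset.sum_coe_sort] at this
            exact this
        _ = _ := by simp
    refine (Finset.sum_le_card_nsmul _ _ _ h1).trans ?_
    rw [card_box, nsmul_eq_mul]
    push_cast
    exact (mul_comm _ _).le

end Averaging

/-! ### Choice of scales -/

/-- Suitable choices of the side `m ≈ n ^ (1/4)` of the averaging box and of the truncation level
`K ≈ log n / 32`, in terms of `u = n ^ (1/16)`. -/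
lemma exists_scales {n : ℕ} (hn : 2 ≤ n) :
    ∃ (u : ℝ) (m K : ℕ), 1 ≤ u ∧ (n : ℝ) = u ^ 16 ∧ Real.log n ≤ 16 * u ∧ 0 < m ∧ 0 < K ∧
      u ^ 4 ≤ m ∧ (m : ℝ) ≤ 2 * u ^ 4 ∧ (3 : ℝ) ^ K ≤ 3 * u ∧ 1 / (K : ℝ) ≤ 32 / Real.log n := by
  have hn1 : (1 : ℝ) < n := by exact_mod_cast (by omega : 1 < n)
  have hn0 : (0 : ℝ) < n := by linarith
  have hlog : 0 < Real.log n := Real.log_pos hn1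
  set u : ℝ := (n : ℝ) ^ (1 / 16 : ℝ) with hu
  have hu1 : 1 ≤ u := Real.one_le_rpow hn1.le (by norm_num)
  have hu16 : (n : ℝ) = u ^ 16 := by
    rw [hu, ← Real.rpow_natCast, ← Real.rpow_mul hn0.le]
    norm_num
  have hu4 : 1 ≤ u ^ 4 := one_le_pow₀ hu1
  have hlogu : Real.log n = 16 * Real.log u := by rw [hu16, Real.log_pow]; norm_num
  set k := ⌊Real.log n / 32⌋₊
  have hk : (k : ℝ) ≤ Real.log n / 32 := Nat.floor_le (by positivity)
  have hk' : Real.log n / 32 < k + 1 := Nat.lt_floor_add_one _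
  refine ⟨u, ⌈u ^ 4⌉₊, k + 1, hu1, hu16, ?_, Nat.ceil_pos.2 (by linarith), by omega,
    Nat.le_ceil _, ?_, ?_, ?_⟩
  · rw [hlogu]
    linarith [Real.log_le_sub_one_of_pos (by linarith : 0 < u)]
  · linarith [(Nat.ceil_lt_add_one (by linarith : 0 ≤ u ^ 4)).le]
  · -- `3 ≤ e ^ 2`, so that `3 ^ k ≤ exp (log n / 16) = u`
    have h3 : (3 : ℝ) ≤ Real.exp 2 := by linarith [Real.add_one_le_exp (2 : ℝ)]
    have h4 : (3 : ℝ) ^ k ≤ u := by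
      calc (3 : ℝ) ^ k ≤ Real.exp 2 ^ k := pow_le_pow_left₀ (by norm_num) h3 k
        _ = Real.exp (k * 2) := (Real.exp_nat_mul 2 k).symm
        _ ≤ Real.exp (Real.log u) := Real.exp_le_exp.2 (by linarith)
        _ = u := Real.exp_log (by linarith)
    rw [pow_succ]
    linarith
  · rw [one_div_le (by positivity) (by positivity), one_div_div]
    push_cast
    exact hk'.le

/-- The variance bound for `m` and `K` as in `exists_scales` is of order `n / log n`. -/
lemma scale_bound_le {d : ℕ} (hd : 2 ≤ d) {a b : ℝ} (ha : 0 < a) (hb : 0 ≤ b) {n : ℕ}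
    {u : ℝ} {m K : ℕ} (hlog : 0 < Real.log n) (hu : 1 ≤ u) (hn : (n : ℝ) = u ^ 16)
    (hlogu : Real.log n ≤ 16 * u) (hm0 : 0 < m) (hmu : u ^ 4 ≤ m) (hm : (m : ℝ) ≤ 2 * u ^ 4)
    (hK : (3 : ℝ) ^ K ≤ 3 * u) (hK' : 1 / (K : ℝ) ≤ 32 / Real.log n) :
    2 * ((b - a) ^ 2 * (3 ^ K * √((b * (d * m + 1) / a + 1) / (m : ℝ) ^ d) + 1 / K)
          * (b * n / a)) + 2 * (2 * b * (d * m)) ^ 2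
      ≤ (2 * (b - a) ^ 2 * (48 * √(b * (d + 1) / a + 1) + 32) * b / a + 512 * (b * d) ^ 2)
          * (n / Real.log n) := by
  have hu0 : 0 < u := by linarith
  have hm1 : (1 : ℝ) ≤ m := by exact_mod_cast hm0
  set c := b * (d + 1) / a + 1 with hc
  have hc0 : 0 ≤ c := by positivity
  have hinv : 1 / u ≤ 16 / Real.log n := by
    rw [div_le_div_iff₀ hu0 hlog]; linarith
  have hQ : (b * (d * m + 1) / a + 1) / (m : ℝ) ^ d ≤ c * (1 / u ^ 2) ^ 2 := by
    have h1 : b * (d * m + 1) / a + 1 ≤ c * m := by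
      have h2 : b * (d * m + 1) / a ≤ b * ((d + 1) * m) / a := by gcongr; linarith
      rw [hc, add_mul, one_mul]
      calc _ ≤ b * ((d + 1) * m) / a + m := add_le_add h2 hm1
        _ = _ := by ring
    have h3 : (m : ℝ) ^ 2 ≤ (m : ℝ) ^ d := pow_le_pow_right₀ hm1 hd
    calc _ ≤ c * m / (m : ℝ) ^ 2 := by gcongr
      _ = c * (1 / m) := by field_simp
      _ ≤ c * (1 / u ^ 4) := by gcongr
      _ = _ := by rw [div_pow, one_pow, ← pow_mul]
  have hsqrt : √((b * (d * m + 1) / a + 1) / (m : ℝ) ^ d) ≤ √c * (1 / u ^ 2) := by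
    refine (Real.sqrt_le_sqrt hQ).trans (le_of_eq ?_)
    rw [Real.sqrt_mul hc0, Real.sqrt_sq (by positivity)]
  have hmain : 3 ^ K * √((b * (d * m + 1) / a + 1) / (m : ℝ) ^ d) + 1 / K
      ≤ (48 * √c + 32) * (1 / Real.log n) := by
    calc _ ≤ (3 * u) * (√c * (1 / u ^ 2)) + 32 / Real.log n := by gcongr
      _ = 3 * √c * (1 / u) + 32 / Real.log n := by field_simp
      _ ≤ 3 * √c * (16 / Real.log n) + 32 / Real.log n := by gcongr
      _ = _ := by ring
  have hsq : 2 * (2 * b * (d * m)) ^ 2 ≤ 512 * (b * d) ^ 2 * (n / Real.log n) := by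
    have h1 : (m : ℝ) ^ 2 ≤ 64 * (n / Real.log n) := by
      have h2 : u ^ 8 ≤ u ^ 15 := pow_le_pow_right₀ hu (by norm_num)
      calc (m : ℝ) ^ 2 ≤ (2 * u ^ 4) ^ 2 := by gcongr
        _ = 4 * u ^ 8 := by ring
        _ ≤ 4 * u ^ 15 := by linarith
        _ = 4 * n * (1 / u) := by rw [hn]; field_simp
        _ ≤ 4 * n * (16 / Real.log n) := by gcongr
        _ = _ := by ring
    calc _ = 8 * (b * d) ^ 2 * (m : ℝ) ^ 2 := by ring
      _ ≤ 8 * (b * d) ^ 2 * (64 * (n / Real.log n)) := by gcongr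
      _ = _ := by ring
  calc _ ≤ 2 * ((b - a) ^ 2 * ((48 * √c + 32) * (1 / Real.log n)) * (b * n / a))
        + 512 * (b * d) ^ 2 * (n / Real.log n) := by gcongr
    _ = _ := by ring

/-! ### From real weights to bits -/

lemma bernoulliLaw_singleton_right {a b : ℝ} (hab : a < b) : bernoulliLaw a b {b} = 2⁻¹ := by
  simp [bernoulliLaw, hab.ne]

lemma bernoulliLaw_compl_singleton_right {a b : ℝ} (hab : a < b) :
    bernoulliLaw a b {b}ᶜ = 2⁻¹ := by
  simp [bernoulliLaw, hab.ne]

lemma ae_bernoulliLaw (a b : ℝ) : ∀ᵐ s ∂bernoulliLaw a b, s = a ∨ s = b := by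
  rw [ae_iff]
  simp [bernoulliLaw]

/-- The events `t e = b` are independent fair bits. -/
lemma isFairBits_decide {d : ℕ} {a b : ℝ} (hab : a < b) {Ω : Type*} [MeasurableSpace Ω]
    {P : Measure Ω} {t : Edge d → Ω → ℝ} (hm : ∀ e, Measurable (t e)) (hi : iIndepFun t P)
    (hlaw : ∀ e, P.map (t e) = bernoulliLaw a b) :
    IsFairBits (fun e ω => decide (t e ω = b)) P := by
  have hdec : Measurable fun s : ℝ => decide (s = b) :=
    measurable_to_bool (by
      have : (fun s : ℝ => decide (s = b)) ⁻¹' {true} = {b} := by ext s; simp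
      rw [this]; exact measurableSet_singleton b)
  refine ⟨fun e => hdec.comp (hm e), hi.comp (fun _ s => decide (s = b)) fun _ => hdec,
    fun e c => ?_⟩
  cases c
  · rw [← bernoulliLaw_compl_singleton_right hab, ← hlaw e,
      Measure.map_apply (hm e) (measurableSet_singleton b).compl]
    congr 1; ext ω; simp
  · rw [← bernoulliLaw_singleton_right hab, ← hlaw e,
      Measure.map_apply (hm e) (measurableSet_singleton b)]
    congr 1; ext ω; simp

lemma ae_eq_bitWeight {d : ℕ} {a b : ℝ} {Ω : Type*} [MeasurableSpace Ω]
    {P : Measure Ω} {t : Edge d → Ω → ℝ} (hm : ∀ e, Measurable (t e))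
    (hlaw : ∀ e, P.map (t e) = bernoulliLaw a b) :
    ∀ᵐ ω ∂P, (fun e => t e ω) = bitWeight a b fun e => decide (t e ω = b) := by
  have h : ∀ᵐ ω ∂P, ∀ e, t e ω = a ∨ t e ω = b := by
    refine ae_all_iff.2 fun e => ae_of_ae_map (p := fun s => s = a ∨ s = b)
      (hm e).aemeasurable ?_
    rw [hlaw e]
    exact ae_bernoulliLaw a b
  filter_upwards [h] with ω hω
  ext e
  simp only [bitWeight, decide_eq_true_eq]
  split_ifs with hb
  · exact hb
  · exact (hω e).resolve_right hb

lemma dist1_axisPoint {d : ℕ} (hd : 0 < d) (n : ℕ) : dist1 0 (axisPoint d n) = n := by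
  rw [dist1, Finset.sum_eq_single ⟨0, hd⟩]
  · simp [axisPoint]
  · intro i _ hi
    have : i.val ≠ 0 := fun h => hi (Fin.ext h)
    simp [axisPoint, this]
  · intro h; exact absurd (Finset.mem_univ _) h

end FPP

theorem mainTheorem3 (d : ℕ) (hd : 2 ≤ d) (a b : ℝ) (ha : 0 < a) (hab : a < b) :
    ∃ C : ℝ, 0 < C ∧
      ∀ (Ω : Type*) [MeasurableSpace Ω] (P : Measure Ω) [IsProbabilityMeasure P]
        (t : FPP.Edge d → Ω → ℝ),
        (∀ e, Measurable (t e)) →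
        iIndepFun t P →
        (∀ e, P.map (t e) = FPP.bernoulliLaw a b) →
        ∀ n : ℕ, 2 ≤ n →
          MemLp (fun ω => FPP.passageTime (fun e => t e ω) 0 (FPP.axisPoint d n)) 2 P ∧
          Var[fun ω => FPP.passageTime (fun e => t e ω) 0 (FPP.axisPoint d n); P]
            ≤ C * ((n : ℝ) / Real.log n) := by
  have hb : 0 < b := ha.trans hab
  have hd0 : (0 : ℝ) < d := by exact_mod_cast (by omega : 0 < d)
  refine ⟨2 * (b - a) ^ 2 * (48 * √(b * (d + 1) / a + 1) + 32) * b / a + 512 * (b * d) ^ 2,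
    by positivity, ?_⟩
  intro Ω _ P _ t hm hi hlaw n hn
  have hlog : 0 < Real.log n := Real.log_pos (by exact_mod_cast (by omega : 1 < n))
  have hX := FPP.isFairBits_decide hab hm hi hlaw
  have hae : (fun ω => FPP.passageTime (FPP.bitWeight a b fun e => decide (t e ω = b)) 0
      (FPP.axisPoint d n)) =ᵐ[P]
      fun ω => FPP.passageTime (fun e => t e ω) 0 (FPP.axisPoint d n) := by
    filter_upwards [FPP.ae_eq_bitWeight hm hlaw] with ω hω
    rw [hω]
  obtain ⟨u, m, K, hu, hnu, hlogu, hm0, hK0, hmu, hmu', hK, hK'⟩ := FPP.exists_scales hn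
  obtain ⟨h1, h2⟩ := FPP.variance_passageTime_le hX ha hab.le hm0 hK0 0 (FPP.axisPoint d n)
  rw [FPP.dist1_axisPoint (by omega) n] at h2
  refine ⟨(memLp_congr_ae hae).1 h1, ?_⟩
  rw [← variance_congr hae]
  exact h2.trans (FPP.scale_bound_le hd ha hb.le hlog hu hnu hlogu hm0 hmu hmu' hK hK')
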